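/- **Setting.** Fix $R,L,S>0$. In each round $t=1,\dots,T$ a learner chooses an action $X_t$ in the ball $D=\{x\in\mathbb R^d:\|x\|\le L\}$ and observes $Y_t=\langle X_t,\theta_t\rangle+\eta_t$, with $\eta_t$ i.i.d. $N(0,R^2)$ (a sub-Gaussian law with variance proxy $R$). A policy $\pi$ chooses $X_t$, possibly at random, on the basis of $X_1,Y_1,\dots,X_{t-1},Y_{t-1}$; it may depend on $d$, $T$, $B_T$, $R$, $L$, $S$. Let $\Theta(B_T)$ be the set of sequences $\theta_1,\dots,\theta_T\in\mathbb R^d$ with $\|\theta_t\|\le S$ and $|\langle x,\theta_t\rangle|\le 1$ for all $x\in D$ and all $t$, and $\sum_{t=1}^{T-1}\|\theta_{t+1}-\theta_t\|\le B_T$. For a class $C$ of sequences put $$\mathcal R_T(\pi;C)=\sup_{\theta_{1:T}\in C}\mathbf E\Big[\sum_{t=1}^T\Big(\max_{x\in D}\langle x,\theta_t\rangle-\langle X_t,\theta_t\rangle\Big)\Big],$$ and let $\mathcal R_T(\pi)=\mathcal R_T(\pi;\Theta(B_T))$ be the dynamic regret. **Theorem.** There is a constant $c>0$ that depends only on $R,L,S$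 such that the following hold. 1. For all $d\ge1$, all $T\ge d$, all $B_T>0$ and every policy $\pi$, $$\mathcal R_T(\pi)\ \ge\ c\,\min\big\{T,\ d^{2/3}B_T^{1/3}T^{2/3}\big\}.$$ In particular $\mathcal R_T(\pi)\ge c\,d^{2/3}B_T^{1/3}T^{2/3}$ whenever $d^2B_T\le T$. 2. Let $d\ge 1$ be fixed and let $(B_T)_{T}$ be positive with $B_T=\Theta(T^\rho)$ for some $\rho\in(0,1)$. Then for all sufficiently large $T$ every policy satisfies $\mathcal R_T(\pi)\ge c\,d^{2/3}B_T^{1/3}T^{2/3}$; and there is $c'>0$, which may depend on $R,L,S$, on $d$ and on the sequence $(B_T)$, such that $\mathcal R_T(\pi)\ge c'\,d^{2/3}B_T^{1/3}T^{2/3}$ for all $T\ge d$ and every policy $\pi$. 3. Let $d\ge1$, $T\ge d$, $0<B_T\le dT$ and $H=\lceil (dT/B_T)^{2/3}\rceil$, and suppose that $d/(2\sqrt H)\le S$ and $L\,d/(2\sqrt H)\le1$. Let $C_H$ be the set of those $\theta_{1:T}\in\Theta(B_T)$ that are constant on each of the consecutive blocks of $H$ rounds (the last block may be shorter) and take all their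 values in $\{\pm\sqrt{d/(4H)}\}^d$. Then $\mathcal R_T(\pi;C_H)\ge c\,d^{2/3}B_T^{1/3}T^{2/3}$ for every policy $\pi$. -/

import Mathlib

open MeasureTheory ProbabilityTheory Filter Asymptotics

noncomputable section

namespace DriftingBandit

/-- Actions and parameters live in Euclidean `ℝ^d`. -/
abbrev Vec (d : ℕ) : Type := EuclideanSpace ℝ (Fin d)

/-- A history of `n` rounds: the actions played and the rewards observed. Rounds are numbered from
`0`, so round `t` here is round `t + 1` in the usual numbering. -/
abbrev History (d n : ℕ) : Type := Fin n → Vec d × ℝ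

/-- A (randomized, history dependent) policy for the decision sets `D 0, D 1, …`: in round `n` the
action is drawn from a probability distribution on `D n` that depends measurably on the history of
the first `n` rounds. -/
structure Policy (d : ℕ) (D : ℕ → Set (Vec d)) where
  act : (n : ℕ) → Kernel (History d n) (Vec d)
  markov : ∀ n, IsMarkovKernel (act n)
  mem : ∀ n h, ∀ᵐ x ∂(act n h), x ∈ D n

variable {d : ℕ} {D : ℕ → Set (Vec d)}

/-- Law of the pair (action, reward) of round `n` given the past: the action `x` comes from the
policy, the noise `η` has law `ν` and is independent of the past and of `x`, and the reward is
`⟪x, θ n⟫ + η`. -/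
def roundKernel (π : Policy d D) (ν : Measure ℝ) (θ : ℕ → Vec d) (n : ℕ) :
    Kernel (History d n) (Vec d × ℝ) :=
  ((π.act n) ×ₖ (Kernel.const (History d n) ν)).map
    (fun p : Vec d × ℝ => (p.1, inner ℝ p.1 (θ n) + p.2))

/-- Law of the history of the first `n` rounds when policy `π` is run against the parameter
sequence `θ` with i.i.d. noise of law `ν`. -/
def historyLaw (π : Policy d D) (ν : Measure ℝ) (θ : ℕ → Vec d) : (n : ℕ) → Measure (History d n)
  | 0 => Measure.dirac (fun i => i.elim0)
  | n + 1 => ((historyLaw π ν θ n) ⊗ₘ (roundKernel π ν θ n)).map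
      (fun p : History d n × (Vec d × ℝ) =>
        (Fin.snoc (α := fun _ => Vec d × ℝ) p.1 p.2 : History d (n + 1)))

/-- Expected cumulative regret over `T` rounds, against the best action of every single round. -/
def expectedRegret (π : Policy d D) (ν : Measure ℝ) (T : ℕ) (θ : ℕ → Vec d) : ℝ :=
  ∫ h : History d T,
    ∑ t : Fin T, ((⨆ x : D t, inner ℝ (x : Vec d) (θ t)) - inner ℝ (h t).1 (θ t))
    ∂(historyLaw π ν θ T)

/-- Dynamic regret over `T` rounds: worst case of the expected regret over a class of parameter
sequences. -/
def dynamicRegret (π : Policy d D) (ν : Measure ℝ) (T : ℕ) (C : Set (ℕ → Vec d)) : EReal :=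
  ⨆ θ ∈ C, (expectedRegret π ν T θ : EReal)

/-- Total variation of a parameter sequence over the rounds `0, …, T - 1`. -/
def variation (T : ℕ) (θ : ℕ → Vec d) : ℝ :=
  ∑ t ∈ Finset.range (T - 1), ‖θ (t + 1) - θ t‖

/-- The admissible parameter sequences: norms at most `S`, mean rewards in `[-1, 1]`, and total
variation at most `B`. Only the first `T` rounds are constrained. -/
def admissible (D : ℕ → Set (Vec d)) (S : ℝ) (T : ℕ) (B : ℝ) : Set (ℕ → Vec d) :=
  {θ | (∀ t < T, ‖θ t‖ ≤ S ∧ ∀ x ∈ D t, |inner ℝ x (θ t)| ≤ 1) ∧ variation T θ ≤ B}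

/-- The sequences that are constant on consecutive blocks of `H` rounds (the last block may be
shorter), with all values in `{± √(d / (4 H))} ^ d`. -/
def blockSequences (d T H : ℕ) : Set (ℕ → Vec d) :=
  {θ | ∃ β : ℕ → Vec d,
    (∀ j i, β j i = √((d : ℝ) / (4 * H)) ∨ β j i = -√((d : ℝ) / (4 * H))) ∧
    ∀ t < T, θ t = β (t / H)}

/-- Every round offers the closed Euclidean ball of radius `L`. -/
def ballSets (d : ℕ) (L : ℝ) : ℕ → Set (Vec d) := fun _ => Metric.closedBall 0 L

/-- Centered Gaussian noise of standard deviation `R`, the standard sub-Gaussian law with variance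
proxy `R`. -/
def noise (R : ℝ) : Measure ℝ := gaussianReal 0 (Real.toNNReal (R ^ 2))

/-- The rate `d^(2/3) B^(1/3) T^(2/3)`. -/
def rate (d T : ℕ) (B : ℝ) : ℝ :=
  (d : ℝ) ^ (2 / 3 : ℝ) * B ^ (1 / 3 : ℝ) * (T : ℝ) ^ (2 / 3 : ℝ)

/-- The block length `⌈(d T / B)^(2/3)⌉`. -/
def blockLength (d T : ℕ) (B : ℝ) : ℕ := ⌈((d : ℝ) * T / B) ^ (2 / 3 : ℝ)⌉₊

end DriftingBandit

end

/-!
The hard instances cut the rounds into blocks of length `H` and give every block a parameter of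
norm `α` whose `d` coordinates have random signs. Since the ball is strongly convex, the regret of
an action `x` against the direction `u` is at least `α / (2 L)` times `‖x - L • u‖ ^ 2`, which is a
sum over coordinates, so a policy must guess each sign of each block separately. Flipping the
`i`-th sign of one block changes the parameter only in that coordinate; the resulting
Kullback–Leibler divergence is proportional to the sum of the squared `i`-th coordinates of the
actions, and these add up to at most `H L ^ 2` over all `i` and all rounds of the block. As long as
`α ≤ d / (2 √H)`, an average coordinate therefore costs a bounded divergence, the two signs cannot
be told apart, and the regret is at least a constant times `α T`. The sequences have variation at
most `2 α T / H`, so `H = ⌈(d T / B) ^ (2 / 3)⌉` is the block length at which `α = d / (2 √H)`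
exhausts the budget `B`, and `α T` is then of the order of the rate.
-/

noncomputable section

namespace DriftingBandit

open scoped ENNReal NNReal symmDiff

/-! ### Comparing two probability measures -/

section TwoPoint

variable {Ω : Type*} [MeasurableSpace Ω] {P : Measure Ω} {w w' V f g : Ω → ℝ}

lemma integral_withDensity_exp (hw : Measurable w) (f : Ω → ℝ) :
    ∫ ω, f ω ∂(P.withDensity fun ω => ENNReal.ofReal (Real.exp (w ω))) =
      ∫ ω, Real.exp (w ω) * f ω ∂P := by
  rw [integral_withDensity_eq_integral_toReal_smul (by fun_prop) (by simp)]
  simp only [ENNReal.toReal_ofReal (Real.exp_pos _).le, smul_eq_mul]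

lemma integrable_withDensity_exp_iff (hw : Measurable w) :
    Integrable f (P.withDensity fun ω => ENNReal.ofReal (Real.exp (w ω))) ↔
      Integrable (fun ω => Real.exp (w ω) * f ω) P := by
  rw [integrable_withDensity_iff_integrable_smul' (by fun_prop) (by simp)]
  simp only [ENNReal.toReal_ofReal (Real.exp_pos _).le, smul_eq_mul]

lemma integrable_min_one_exp [IsFiniteMeasure P] (hw : Measurable w) :
    Integrable (fun ω => min 1 (Real.exp (w ω))) P := by
  refine Integrable.of_bound (by fun_prop) 1 (ae_of_all _ fun ω => ?_)
  rw [Real.norm_of_nonneg (by positivity)]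
  exact min_le_left _ _

lemma mul_integral_min_one_exp_le [IsFiniteMeasure P] (hw : Measurable w) {c : ℝ}
    (hf : ∀ ω, 0 ≤ f ω) (hg : ∀ ω, 0 ≤ g ω) (hfg : ∀ ω, c ≤ f ω + g ω) (hfi : Integrable f P)
    (hgi : Integrable g (P.withDensity fun ω => ENNReal.ofReal (Real.exp (w ω)))) :
    c * ∫ ω, min 1 (Real.exp (w ω)) ∂P ≤
      ∫ ω, f ω ∂P + ∫ ω, g ω ∂(P.withDensity fun ω => ENNReal.ofReal (Real.exp (w ω))) := by
  have hgi' := (integrable_withDensity_exp_iff hw).1 hgi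
  rw [integral_withDensity_exp hw, ← integral_add hfi hgi', ← integral_const_mul]
  refine integral_mono ((integrable_min_one_exp hw).const_mul c) (hfi.add hgi') fun ω => ?_
  calc c * min 1 (Real.exp (w ω))
      ≤ (f ω + g ω) * min 1 (Real.exp (w ω)) :=
        mul_le_mul_of_nonneg_right (hfg ω) (by positivity)
    _ = f ω * min 1 (Real.exp (w ω)) + min 1 (Real.exp (w ω)) * g ω := by ring
    _ ≤ f ω * 1 + Real.exp (w ω) * g ω :=
        add_le_add (mul_le_mul_of_nonneg_left (min_le_left _ _) (hf ω))
          (mul_le_mul_of_nonneg_right (min_le_right _ _) (hg ω))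
    _ = f ω + Real.exp (w ω) * g ω := by rw [mul_one]

lemma exp_neg_sq_le_min_mul {a b v : ℝ} (hv : 0 ≤ v) (h : a + b = -(2 * v)) :
    Real.exp (-v) ^ 2 ≤ min 1 (Real.exp a) * (1 + Real.exp b) := by
  have hprod : Real.exp (-v) ^ 2 = Real.exp a * Real.exp b := by
    rw [← Real.exp_add, h, ← Real.exp_nat_mul]
    congr 1
    push_cast
    ring
  rcases min_cases 1 (Real.exp a) with ⟨hm, -⟩ | ⟨hm, -⟩ <;> rw [hm]
  · have : Real.exp (-v) ^ 2 ≤ 1 := pow_le_one₀ (Real.exp_pos _).le (by simpa using hv)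
    linarith [Real.exp_pos b]
  · rw [hprod]
    nlinarith [Real.exp_pos a]

lemma exp_neg_sq_mul_le_min_add {a b v : ℝ} (m : ℝ) (hv : 0 ≤ v) (h : a + b = -(2 * v)) :
    Real.exp (-m) ^ 2 * (1 + m - v) ≤
      min 1 (Real.exp a) + Real.exp (-m) ^ 2 / 4 * (1 + Real.exp b) := by
  set s := Real.exp (-m)
  have htangent : s * (1 + m - v) ≤ Real.exp (-v) := by
    calc s * (1 + m - v) ≤ s * Real.exp (m - v) := by
          gcongr
          linarith [Real.add_one_le_exp (m - v)]
      _ = Real.exp (-v) := by rw [← Real.exp_add]; ring_nf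
  have hamgm : s * Real.exp (-v) ≤ min 1 (Real.exp a) + s ^ 2 / 4 * (1 + Real.exp b) := by
    refine (abs_le_of_sq_le_sq' ?_ (by positivity)).2
    calc (s * Real.exp (-v)) ^ 2 = s ^ 2 * Real.exp (-v) ^ 2 := mul_pow _ _ _
      _ ≤ s ^ 2 * (min 1 (Real.exp a) * (1 + Real.exp b)) := by
          gcongr
          exact exp_neg_sq_le_min_mul hv h
      _ = 4 * min 1 (Real.exp a) * (s ^ 2 / 4 * (1 + Real.exp b)) := by ring
      _ ≤ _ := four_mul_le_sq_add _ _
  calc s ^ 2 * (1 + m - v) = s * (s * (1 + m - v)) := by ring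
    _ ≤ s * Real.exp (-v) := mul_le_mul_of_nonneg_left htangent (Real.exp_pos _).le
    _ ≤ _ := hamgm

-- A Bretagnolle–Huber inequality in which the third measure of density `exp w'` replaces the
-- computation of a Kullback–Leibler divergence: `exp (-V)` is the geometric mean of the densities
-- `exp w` and `exp w'`, so that no moment of `w` enters.
lemma exp_neg_two_mul_integral_div_two_le [IsProbabilityMeasure P] (hw : Measurable w)
    (hw' : Integrable (fun ω => Real.exp (w' ω)) P) (hw'_one : ∫ ω, Real.exp (w' ω) ∂P ≤ 1)
    (hV : Integrable V P) (hV_nonneg : ∀ ω, 0 ≤ V ω) (h : ∀ ω, w ω + w' ω = -(2 * V ω)) :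
    Real.exp (-2 * ∫ ω, V ω ∂P) / 2 ≤ ∫ ω, min 1 (Real.exp (w ω)) ∂P := by
  set m := ∫ ω, V ω ∂P
  set s := Real.exp (-m)
  have hs : Real.exp (-2 * m) = s ^ 2 := by
    rw [← Real.exp_nat_mul]
    congr 1
    push_cast
    ring
  have hmin := integrable_min_one_exp (P := P) hw
  have hrest : Integrable (fun ω => s ^ 2 / 4 * (1 + Real.exp (w' ω))) P :=
    ((integrable_const 1).add hw').const_mul _
  have hmono := integral_mono (((integrable_const (1 + m)).sub hV).const_mul (s ^ 2))
    (hmin.add hrest) fun ω => exp_neg_sq_mul_le_min_add m (hV_nonneg ω) (h ω)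
  simp only [Pi.sub_apply, Pi.add_apply] at hmono
  rw [integral_const_mul, integral_sub (integrable_const _) hV, integral_add hmin hrest,
    integral_const_mul, integral_add (integrable_const 1) hw'] at hmono
  simp only [integral_const, probReal_univ, one_smul] at hmono
  rw [hs]
  nlinarith [mul_le_mul_of_nonneg_left hw'_one (sq_nonneg s)]

end TwoPoint

lemma card_mul_exp_le_sum_exp {ι : Type*} (s : Finset ι) (x : ι → ℝ) {k : ℝ}
    (hk : s.card * k ≤ ∑ i ∈ s, x i) : s.card * Real.exp k ≤ ∑ i ∈ s, Real.exp (x i) := by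
  rcases s.eq_empty_or_nonempty with rfl | hs
  · simp
  have hcard : 0 < (s.card : ℝ) := by exact_mod_cast hs.card_pos
  have hjensen := convexOn_exp.map_sum_le (t := s) (w := fun _ => (s.card : ℝ)⁻¹) (p := x)
    (fun _ _ => by positivity)
    (by rw [Finset.sum_const, nsmul_eq_mul, mul_inv_cancel₀ hcard.ne']) fun _ _ => Set.mem_univ _
  rw [← Finset.smul_sum, ← Finset.smul_sum, smul_eq_mul, smul_eq_mul,
    le_inv_mul_iff₀ hcard] at hjensen
  refine le_trans ?_ hjensen
  gcongr
  exact (le_inv_mul_iff₀ hcard).2 hk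

/-! ### Averaging over the hypercube -/

-- Assouad's argument: averaged over `A ⊆ s`, the flip `A ↦ A ∆ {i}` leaves `E · i` unchanged.
lemma exists_half_le_sum_of_le_sum_add_flip {ι : Type*} [DecidableEq ι] (s : Finset ι)
    (E : Finset ι → ι → ℝ) {M : ℝ} (h : ∀ A, M ≤ ∑ i ∈ s, (E A i + E (A ∆ {i}) i)) :
    ∃ A, M / 2 ≤ ∑ i ∈ s, E A i := by
  have hflip : ∀ i ∈ s, ∑ A ∈ s.powerset, E (A ∆ {i}) i = ∑ A ∈ s.powerset, E A i :=
    fun i hi => by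
      have hmem : ∀ A ∈ s.powerset, A ∆ {i} ∈ s.powerset := fun A hA => by
        rw [Finset.mem_powerset] at hA ⊢
        exact symmDiff_le_sup.trans (Finset.union_subset hA (Finset.singleton_subset_iff.2 hi))
      exact Finset.sum_nbij' (· ∆ {i}) (· ∆ {i}) hmem hmem
        (fun A _ => symmDiff_symmDiff_cancel_right _ _)
        (fun A _ => symmDiff_symmDiff_cancel_right _ _) fun A _ => rfl
  have htotal : ∑ A ∈ s.powerset, ∑ i ∈ s, (E A i + E (A ∆ {i}) i) =
      2 * ∑ A ∈ s.powerset, ∑ i ∈ s, E A i := by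
    simp only [Finset.sum_add_distrib, two_mul]
    congr 1
    rw [Finset.sum_comm, Finset.sum_comm (s := s.powerset)]
    exact Finset.sum_congr rfl hflip
  have hmean : ∑ A ∈ s.powerset, M / 2 ≤ ∑ A ∈ s.powerset, ∑ i ∈ s, E A i := by
    rw [← Finset.sum_div, div_le_iff₀' two_pos, ← htotal]
    exact Finset.sum_le_sum fun A _ => h A
  obtain ⟨A, -, hA⟩ := Finset.exists_le_of_sum_le ⟨∅, Finset.empty_mem_powerset s⟩ hmean
  exact ⟨A, hA⟩

/-! ### Linear functionals on a ball -/

section Ball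

variable {E : Type*} [NormedAddCommGroup E] [InnerProductSpace ℝ E] {L : ℝ}

lemma iSup_inner_closedBall (hL : 0 ≤ L) (v : E) :
    ⨆ x : Metric.closedBall (0 : E) L, inner ℝ (x : E) v = L * ‖v‖ := by
  have : Nonempty (Metric.closedBall (0 : E) L) := ⟨⟨0, Metric.mem_closedBall_self hL⟩⟩
  refine IsLUB.ciSup_eq (IsGreatest.isLUB ⟨⟨⟨(L / ‖v‖) • v, ?_⟩, ?_⟩, ?_⟩)
  · rw [mem_closedBall_zero_iff, norm_smul, norm_div, norm_norm, Real.norm_of_nonneg hL,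
      div_mul_eq_mul_div, mul_div_assoc]
    exact mul_le_of_le_one_right hL (div_self_le_one _)
  · rcases eq_or_ne v 0 with rfl | hv
    · simp
    · have : ‖v‖ ≠ 0 := norm_ne_zero_iff.2 hv
      simp only [real_inner_smul_left, real_inner_self_eq_norm_sq]
      field_simp
  · rintro _ ⟨x, rfl⟩
    exact (real_inner_le_norm _ _).trans (by gcongr; exact mem_closedBall_zero_iff.1 x.2)

lemma norm_sub_smul_sq_le {x u : E} (hx : ‖x‖ ≤ L) (hu : ‖u‖ = 1) :
    ‖x - L • u‖ ^ 2 ≤ 2 * L * (L - inner ℝ x u) := by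
  have hx_sq : ‖x‖ ^ 2 ≤ L ^ 2 := pow_le_pow_left₀ (norm_nonneg x) hx 2
  rw [norm_sub_sq_real, real_inner_smul_right, norm_smul, hu, mul_one, Real.norm_eq_abs, sq_abs]
  linarith

end Ball

/-! ### Change of measure -/

lemma gaussianReal_eq_withDensity_exp {v : ℝ≥0} (hv : v ≠ 0) (m : ℝ) :
    gaussianReal m v = (gaussianReal 0 v).withDensity
      fun y => ENNReal.ofReal (Real.exp ((y * m - m ^ 2 / 2) / v)) := by
  have hv' : (v : ℝ) ≠ 0 := NNReal.coe_ne_zero.2 hv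
  rw [gaussianReal_of_var_ne_zero _ hv, gaussianReal_of_var_ne_zero _ hv,
    ← withDensity_mul _ (measurable_gaussianPDF _ _) (by fun_prop)]
  congr 1 with y
  rw [Pi.mul_apply, gaussianPDF, gaussianPDF, ← ENNReal.ofReal_mul (gaussianPDFReal_nonneg _ _ _),
    gaussianPDFReal, gaussianPDFReal, mul_assoc _ (Real.exp _), ← Real.exp_add]
  congr 3
  field_simp
  ring

lemma lintegral_gaussianReal_add_const {v : ℝ≥0} (hv : v ≠ 0) (m : ℝ) {F : ℝ → ℝ≥0∞}
    (hF : Measurable F) :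
    ∫⁻ η, F (m + η) ∂(gaussianReal 0 v) =
      ∫⁻ y, ENNReal.ofReal (Real.exp ((y * m - m ^ 2 / 2) / v)) * F y ∂(gaussianReal 0 v) := by
  have hmap := gaussianReal_map_const_add (μ := 0) (v := v) m
  rw [zero_add] at hmap
  have htilt := lintegral_withDensity_eq_lintegral_mul (gaussianReal 0 v)
    (f := fun y => ENNReal.ofReal (Real.exp ((y * m - m ^ 2 / 2) / v))) (by fun_prop) hF
  rw [← gaussianReal_eq_withDensity_exp hv, ← hmap, lintegral_map hF (by fun_prop)] at htilt
  exact htilt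

section HistoryLaw

variable {d : ℕ} {D : ℕ → Set (Vec d)}

lemma measurable_snoc (n : ℕ) : Measurable fun p : History d n × (Vec d × ℝ) =>
    (Fin.snoc (α := fun _ => Vec d × ℝ) p.1 p.2 : History d (n + 1)) := by
  refine measurable_pi_iff.2 (Fin.lastCases ?_ fun j => ?_)
  · simpa only [Fin.snoc_last] using measurable_snd
  · simp only [Fin.snoc_castSucc]
    fun_prop

instance isProbabilityMeasure_noise (R : ℝ) : IsProbabilityMeasure (noise R) :=
  inferInstanceAs (IsProbabilityMeasure (gaussianReal _ _))

instance isMarkovKernel_roundKernel (π : Policy d D) (ν : Measure ℝ) [IsProbabilityMeasure ν]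
    (θ : ℕ → Vec d) (n : ℕ) : IsMarkovKernel (roundKernel π ν θ n) :=
  have := π.markov n
  Kernel.IsMarkovKernel.map _ (by fun_prop)

instance isProbabilityMeasure_historyLaw (π : Policy d D) (ν : Measure ℝ) [IsProbabilityMeasure ν]
    (θ : ℕ → Vec d) (n : ℕ) : IsProbabilityMeasure (historyLaw π ν θ n) := by
  induction n with
  | zero => rw [historyLaw]; infer_instance
  | succ n ih =>
    rw [historyLaw]
    exact Measure.isProbabilityMeasure_map (measurable_snoc n).aemeasurable

lemma lintegral_roundKernel (π : Policy d D) (ν : Measure ℝ) [IsProbabilityMeasure ν]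
    (θ : ℕ → Vec d) (n : ℕ) (h : History d n) {G : Vec d × ℝ → ℝ≥0∞} (hG : Measurable G) :
    ∫⁻ q, G q ∂(roundKernel π ν θ n h) =
      ∫⁻ x, ∫⁻ η, G (x, inner ℝ x (θ n) + η) ∂ν ∂(π.act n h) := by
  have := π.markov n
  rw [roundKernel, Kernel.lintegral_map _ (by fun_prop) _ hG,
    Kernel.lintegral_prod _ _ _ (by fun_prop)]
  simp only [Kernel.const_apply]

lemma lintegral_historyLaw_succ (π : Policy d D) (ν : Measure ℝ) [IsProbabilityMeasure ν]
    (θ : ℕ → Vec d) (n : ℕ) {F : History d (n + 1) → ℝ≥0∞} (hF : Measurable F) :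
    ∫⁻ h, F h ∂(historyLaw π ν θ (n + 1)) =
      ∫⁻ h, ∫⁻ q, F (Fin.snoc (α := fun _ => Vec d × ℝ) h q) ∂(roundKernel π ν θ n h)
        ∂(historyLaw π ν θ n) := by
  rw [historyLaw, lintegral_map hF (measurable_snoc n)]
  exact Measure.lintegral_compProd (hF.comp (measurable_snoc n))

/-- The log-likelihood ratio of one round when the parameter is changed from `v` to `v + w`. -/
def roundLogRatio (R : ℝ) (v w : Vec d) (q : Vec d × ℝ) : ℝ :=
  ((q.2 - inner ℝ q.1 v) * inner ℝ q.1 w - inner ℝ q.1 w ^ 2 / 2) / R ^ 2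

/-- The log-likelihood ratio of a history when the parameters are changed from `θ` to `θ + δ`. -/
def logRatio (R : ℝ) (θ δ : ℕ → Vec d) (n : ℕ) (h : History d n) : ℝ :=
  ∑ t : Fin n, roundLogRatio R (θ t) (δ t) (h t)

@[fun_prop]
lemma measurable_roundLogRatio (R : ℝ) (v w : Vec d) : Measurable (roundLogRatio R v w) := by
  unfold roundLogRatio
  fun_prop

@[fun_prop]
lemma measurable_logRatio (R : ℝ) (θ δ : ℕ → Vec d) (n : ℕ) : Measurable (logRatio R θ δ n) := by
  unfold logRatio
  fun_prop

lemma logRatio_snoc (R : ℝ) (θ δ : ℕ → Vec d) {n : ℕ} (h : History d n) (q : Vec d × ℝ) :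
    logRatio R θ δ (n + 1) (Fin.snoc (α := fun _ => Vec d × ℝ) h q) =
      logRatio R θ δ n h + roundLogRatio R (θ n) (δ n) q := by
  simp only [logRatio, Fin.sum_univ_castSucc, Fin.snoc_castSucc, Fin.snoc_last, Fin.val_castSucc,
    Fin.val_last]

lemma lintegral_roundKernel_add (π : Policy d D) {R : ℝ} (hR : R ≠ 0) (θ δ : ℕ → Vec d) (n : ℕ)
    (h : History d n) {G : Vec d × ℝ → ℝ≥0∞} (hG : Measurable G) :
    ∫⁻ q, G q ∂(roundKernel π (noise R) (θ + δ) n h) =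
      ∫⁻ q, ENNReal.ofReal (Real.exp (roundLogRatio R (θ n) (δ n) q)) * G q
        ∂(roundKernel π (noise R) θ n h) := by
  have hv : Real.toNNReal (R ^ 2) ≠ 0 := (Real.toNNReal_pos.2 (by positivity)).ne'
  rw [lintegral_roundKernel _ _ _ _ _ hG, lintegral_roundKernel _ _ _ _ _ (by fun_prop)]
  refine lintegral_congr fun x => ?_
  have hshift := lintegral_gaussianReal_add_const hv (inner ℝ x (δ n))
    (F := fun y => G (x, inner ℝ x (θ n) + y)) (by fun_prop)
  rw [Real.coe_toNNReal _ (sq_nonneg R)] at hshift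
  simp only [roundLogRatio, add_sub_cancel_left, Pi.add_apply, inner_add_right, add_assoc]
  exact hshift

lemma lintegral_historyLaw_add (π : Policy d D) {R : ℝ} (hR : R ≠ 0) (θ δ : ℕ → Vec d) (n : ℕ)
    {F : History d n → ℝ≥0∞} (hF : Measurable F) :
    ∫⁻ h, F h ∂(historyLaw π (noise R) (θ + δ) n) =
      ∫⁻ h, ENNReal.ofReal (Real.exp (logRatio R θ δ n h)) * F h
        ∂(historyLaw π (noise R) θ n) := by
  induction n with
  | zero => simp [historyLaw, logRatio]
  | succ n ih =>
    have hsnoc := measurable_snoc (d := d) n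
    have hinner : Measurable fun h : History d n => ∫⁻ q,
        F (Fin.snoc (α := fun _ => Vec d × ℝ) h q) ∂(roundKernel π (noise R) (θ + δ) n h) :=
      (hF.comp hsnoc).lintegral_kernel_prod_right'
    rw [lintegral_historyLaw_succ _ _ _ _ hF, lintegral_historyLaw_succ _ _ _ _ (by fun_prop),
      ih hinner]
    refine lintegral_congr fun h => ?_
    have hFh : Measurable fun q => F (Fin.snoc (α := fun _ => Vec d × ℝ) h q) :=
      hF.comp (hsnoc.comp (by fun_prop : Measurable fun q : Vec d × ℝ => (h, q)))
    rw [lintegral_roundKernel_add π hR θ δ n h hFh,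
      ← lintegral_const_mul' _ _ ENNReal.ofReal_ne_top]
    refine lintegral_congr fun q => ?_
    rw [logRatio_snoc, Real.exp_add, ENNReal.ofReal_mul (Real.exp_pos _).le, mul_assoc]

lemma historyLaw_add_eq_withDensity (π : Policy d D) {R : ℝ} (hR : R ≠ 0) (θ δ : ℕ → Vec d)
    (n : ℕ) :
    historyLaw π (noise R) (θ + δ) n = (historyLaw π (noise R) θ n).withDensity
      fun h => ENNReal.ofReal (Real.exp (logRatio R θ δ n h)) := by
  refine Measure.ext_of_lintegral _ fun F hF => ?_
  rw [lintegral_historyLaw_add π hR θ δ n hF,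
    lintegral_withDensity_eq_lintegral_mul _ (by fun_prop) hF]
  rfl

/-- The log-likelihood ratio cost of perturbing the parameters by `δ` along a fixed history: its
mean is the Kullback–Leibler divergence between the two history laws. -/
def pathDivergence (R : ℝ) (δ : ℕ → Vec d) (n : ℕ) (h : History d n) : ℝ :=
  ∑ t : Fin n, inner ℝ (h t).1 (δ t) ^ 2 / (2 * R ^ 2)

@[fun_prop]
lemma measurable_pathDivergence (R : ℝ) (δ : ℕ → Vec d) (n : ℕ) :
    Measurable (pathDivergence R δ n) := by
  unfold pathDivergence
  fun_prop

lemma pathDivergence_nonneg (R : ℝ) (δ : ℕ → Vec d) (n : ℕ) (h : History d n) :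
    0 ≤ pathDivergence R δ n h :=
  Finset.sum_nonneg fun _ _ => by positivity

lemma logRatio_add_logRatio_neg (R : ℝ) (θ δ : ℕ → Vec d) (n : ℕ) (h : History d n) :
    logRatio R θ δ n h + logRatio R θ (-δ) n h = -(2 * pathDivergence R δ n h) := by
  simp only [logRatio, pathDivergence, roundLogRatio, Finset.mul_sum, ← Finset.sum_add_distrib,
    ← Finset.sum_neg_distrib, Pi.neg_apply, inner_neg_right]
  refine Finset.sum_congr rfl fun t _ => ?_
  ring

lemma half_mul_exp_neg_pathDivergence_le (π : Policy d D) {R : ℝ} (hR : R ≠ 0) (θ δ : ℕ → Vec d)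
    {n : ℕ} {f g : History d n → ℝ} {c : ℝ} (hc : 0 ≤ c) (hf : ∀ h, 0 ≤ f h) (hg : ∀ h, 0 ≤ g h)
    (hfg : ∀ h, c ≤ f h + g h) (hfi : Integrable f (historyLaw π (noise R) θ n))
    (hgi : Integrable g (historyLaw π (noise R) (θ + δ) n))
    (hdiv : Integrable (pathDivergence R δ n) (historyLaw π (noise R) θ n)) :
    c / 2 * Real.exp (-2 * ∫ h, pathDivergence R δ n h ∂(historyLaw π (noise R) θ n)) ≤
      ∫ h, f h ∂(historyLaw π (noise R) θ n) + ∫ h, g h ∂(historyLaw π (noise R) (θ + δ) n) := by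
  set P := historyLaw π (noise R) θ n
  have hneg := historyLaw_add_eq_withDensity π hR θ (-δ) n
  have htilt_int : Integrable (fun h => Real.exp (logRatio R θ (-δ) n h)) P := by
    have hone : Integrable (fun _ => (1 : ℝ)) (historyLaw π (noise R) (θ + -δ) n) :=
      integrable_const 1
    rw [hneg, integrable_withDensity_exp_iff (by fun_prop)] at hone
    simpa only [mul_one] using hone
  have htilt : ∫ h, Real.exp (logRatio R θ (-δ) n h) ∂P = 1 := by
    have := integral_withDensity_exp (P := P) (measurable_logRatio R θ (-δ) n) fun _ => 1
    rw [← hneg] at this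
    simpa only [mul_one, integral_const, probReal_univ, one_smul] using this.symm
  rw [historyLaw_add_eq_withDensity π hR θ δ n] at hgi ⊢
  calc c / 2 * Real.exp (-2 * ∫ h, pathDivergence R δ n h ∂P)
      = c * (Real.exp (-2 * ∫ h, pathDivergence R δ n h ∂P) / 2) := by ring
    _ ≤ c * ∫ h, min 1 (Real.exp (logRatio R θ δ n h)) ∂P := by
        gcongr
        exact exp_neg_two_mul_integral_div_two_le (measurable_logRatio R θ δ n) htilt_int htilt.le
          hdiv (pathDivergence_nonneg R δ n) (logRatio_add_logRatio_neg R θ δ n)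
    _ ≤ _ := mul_integral_min_one_exp_le (measurable_logRatio R θ δ n) hf hg hfg hfi hgi

lemma ae_historyLaw_mem (hD : ∀ n, MeasurableSet (D n)) (π : Policy d D) (ν : Measure ℝ)
    [IsProbabilityMeasure ν] (θ : ℕ → Vec d) (n : ℕ) :
    ∀ᵐ h ∂(historyLaw π ν θ n), ∀ t : Fin n, (h t).1 ∈ D t := by
  have := π.markov
  induction n with
  | zero => exact ae_of_all _ fun _ t => t.elim0
  | succ n ih =>
    have hmeas : MeasurableSet {h : History d (n + 1) | ∀ t : Fin (n + 1), (h t).1 ∈ D t} := by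
      rw [Set.ofPred_forall]
      exact MeasurableSet.iInter fun t => measurableSet_preimage (by fun_prop) (hD t)
    rw [historyLaw, ae_map_iff (measurable_snoc n).aemeasurable hmeas]
    refine (Measure.ae_compProd_iff (measurable_snoc n hmeas)).2 ?_
    filter_upwards [ih] with h hh
    have hround : ∀ᵐ q ∂(roundKernel π ν θ n h), q.1 ∈ D n := by
      rw [roundKernel, Kernel.map_apply _ (by fun_prop),
        ae_map_iff (by fun_prop) (measurableSet_preimage measurable_fst (hD n)), Kernel.prod_apply]
      exact Measure.quasiMeasurePreserving_fst.ae (π.mem n h)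
    filter_upwards [hround] with q hq
    refine Fin.lastCases ?_ fun j => ?_
    · simpa only [Fin.snoc_last, Fin.val_last] using hq
    · simpa only [Fin.snoc_castSucc, Fin.val_castSucc] using hh j

lemma integrable_historyLaw_of_bound (hD : ∀ n, MeasurableSet (D n)) (π : Policy d D)
    (ν : Measure ℝ) [IsProbabilityMeasure ν] (θ : ℕ → Vec d) {n : ℕ} {f : History d n → ℝ}
    (hf : Measurable f) {M : ℝ} (hM : ∀ h, (∀ t : Fin n, (h t).1 ∈ D t) → |f h| ≤ M) :
    Integrable f (historyLaw π ν θ n) :=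
  Integrable.of_bound hf.aestronglyMeasurable M
    ((ae_historyLaw_mem hD π ν θ n).mono hM)

end HistoryLaw

/-! ### Block sequences with random signs -/

section SignSeq

variable {d : ℕ} {L R α : ℝ} {H : ℕ}

/-- The rounds of block `j`, when `n` rounds are cut into consecutive blocks of length `H`. -/
def block (n H j : ℕ) : Finset (Fin n) := Finset.univ.filter fun t => t / H = j

lemma mem_block {n j : ℕ} {t : Fin n} : t ∈ block n H j ↔ t / H = j := by
  simp only [block, Finset.mem_filter, Finset.mem_univ, true_and]

lemma card_block_le (hH : 1 ≤ H) (n j : ℕ) : (block n H j).card ≤ H := by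
  have hmaps : ∀ t ∈ block n H j, (t : ℕ) ∈ Finset.Ico (j * H) (j * H + H) := fun t ht => by
    have := (Nat.div_eq_iff hH).1 (mem_block.1 ht)
    rw [Finset.mem_Ico]
    omega
  simpa only [Nat.card_Ico, Nat.add_sub_cancel_left] using
    Finset.card_le_card_of_injOn _ hmaps Fin.val_injective.injOn

lemma sum_sum_block (n H : ℕ) (f : ℕ → Fin n → ℝ) :
    ∑ j ∈ Finset.range n, ∑ t ∈ block n H j, f j t = ∑ t : Fin n, f (t / H) t := by
  have hmaps : ∀ t ∈ (Finset.univ : Finset (Fin n)), (t : ℕ) / H ∈ Finset.range n :=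
    fun t _ => Finset.mem_range.2 ((Nat.div_le_self _ _).trans_lt t.2)
  rw [← Finset.sum_fiberwise_of_maps_to hmaps]
  refine Finset.sum_congr rfl fun j _ => Finset.sum_congr rfl fun t ht => ?_
  rw [mem_block.1 ht]

/-- The unit vector all of whose coordinates are `± 1 / √d`, with the minus signs of block `j`
recorded by the finite set `A`. -/
def signDir (A : Finset (ℕ × Fin d)) (j : ℕ) : Vec d :=
  WithLp.toLp 2 fun i => (if (j, i) ∈ A then -1 else 1) / √d

/-- The parameter sequence of norm `α` whose direction on block `j` is `signDir A j`: the hard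
instances of the lower bound. -/
def signSeq (α : ℝ) (H : ℕ) (A : Finset (ℕ × Fin d)) (t : ℕ) : Vec d := α • signDir A (t / H)

lemma signDir_apply_sq (A : Finset (ℕ × Fin d)) (j : ℕ) (i : Fin d) :
    signDir A j i ^ 2 = 1 / d := by
  have hsign : (if (j, i) ∈ A then (-1 : ℝ) else 1) ^ 2 = 1 := by split_ifs <;> norm_num
  rw [signDir, div_pow, hsign, Real.sq_sqrt d.cast_nonneg]

lemma norm_signDir (hd : 1 ≤ d) (A : Finset (ℕ × Fin d)) (j : ℕ) : ‖signDir A j‖ = 1 := by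
  have hd' : (d : ℝ) ≠ 0 := by positivity
  rw [← sq_eq_sq₀ (norm_nonneg _) zero_le_one, EuclideanSpace.real_norm_sq_eq]
  simp only [signDir_apply_sq, Finset.sum_const, Finset.card_univ, Fintype.card_fin, nsmul_eq_mul]
  rw [mul_one_div_cancel hd', one_pow]

lemma norm_smul_signDir (hd : 1 ≤ d) (hα : 0 ≤ α) (A : Finset (ℕ × Fin d)) (j : ℕ) :
    ‖α • signDir A j‖ = α := by
  rw [norm_smul, norm_signDir hd, mul_one, Real.norm_of_nonneg hα]

lemma signDir_symmDiff_self (A : Finset (ℕ × Fin d)) (j : ℕ) (i : Fin d) :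
    signDir (A ∆ {(j, i)}) j = signDir A j - EuclideanSpace.single i (2 * signDir A j i) := by
  ext k
  rcases eq_or_ne k i with rfl | hk
  · simp only [signDir, Finset.mem_symmDiff, Finset.mem_singleton, not_true_eq_false, and_false,
      true_and, false_or, PiLp.sub_apply, PiLp.single_eq_same]
    split_ifs <;> grind
  · simp [signDir, Finset.mem_symmDiff, hk]

lemma signDir_symmDiff_of_ne (A : Finset (ℕ × Fin d)) {j j' : ℕ} (hj : j' ≠ j) (i : Fin d) :
    signDir (A ∆ {(j, i)}) j' = signDir A j' := by
  ext k
  simp [signDir, Finset.mem_symmDiff, hj]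

lemma inner_signSeq_flip_sq (α : ℝ) (H : ℕ) (A : Finset (ℕ × Fin d)) (j : ℕ) (i : Fin d) (t : ℕ)
    (x : Vec d) :
    inner ℝ x ((signSeq α H (A ∆ {(j, i)}) - signSeq α H A) t) ^ 2 =
      if t / H = j then 4 * α ^ 2 / d * x i ^ 2 else 0 := by
  simp only [Pi.sub_apply, signSeq, ← smul_sub, real_inner_smul_right]
  split_ifs with h
  · rw [h, signDir_symmDiff_self, sub_sub_cancel_left, inner_neg_right,
      EuclideanSpace.inner_single_right, conj_trivial]
    linear_combination 4 * α ^ 2 * x i ^ 2 * signDir_apply_sq A j i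
  · rw [signDir_symmDiff_of_ne A h, sub_self, inner_zero_right]
    ring

lemma pathDivergence_signSeq_flip (R α : ℝ) (H : ℕ) (A : Finset (ℕ × Fin d)) (j : ℕ) (i : Fin d)
    {n : ℕ} (h : History d n) :
    pathDivergence R (signSeq α H (A ∆ {(j, i)}) - signSeq α H A) n h =
      2 * α ^ 2 / (d * R ^ 2) * ∑ t ∈ block n H j, (h t).1 i ^ 2 := by
  simp only [pathDivergence, block, inner_signSeq_flip_sq, Finset.mul_sum, Finset.sum_filter]
  refine Finset.sum_congr rfl fun t _ => ?_
  split_ifs <;> ring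

lemma sum_pathDivergence_signSeq_flip_le (hH : 1 ≤ H) (R α : ℝ) (A : Finset (ℕ × Fin d)) (j : ℕ)
    {n : ℕ} {h : History d n} (hh : ∀ t, ‖(h t).1‖ ≤ L) :
    ∑ i, pathDivergence R (signSeq α H (A ∆ {(j, i)}) - signSeq α H A) n h ≤
      2 * α ^ 2 / (d * R ^ 2) * (H * L ^ 2) := by
  simp only [pathDivergence_signSeq_flip]
  rw [← Finset.mul_sum, Finset.sum_comm]
  simp only [← EuclideanSpace.real_norm_sq_eq]
  gcongr
  calc ∑ t ∈ block n H j, ‖(h t).1‖ ^ 2 ≤ (block n H j).card • L ^ 2 :=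
        Finset.sum_le_card_nsmul _ _ _ fun t _ => pow_le_pow_left₀ (norm_nonneg _) (hh t) 2
    _ ≤ H * L ^ 2 := by
        rw [nsmul_eq_mul]
        gcongr
        exact card_block_le hH n j

/-- The squared deviation, over block `j`, of coordinate `i` of the actions from the optimal
action `L • signDir A j`. -/
def coordLoss (L : ℝ) (H : ℕ) (A : Finset (ℕ × Fin d)) (j : ℕ) (i : Fin d) {n : ℕ}
    (h : History d n) : ℝ :=
  ∑ t ∈ block n H j, ((h t).1 i - L * signDir A j i) ^ 2

lemma coordLoss_nonneg (L : ℝ) (H : ℕ) (A : Finset (ℕ × Fin d)) (j : ℕ) (i : Fin d) {n : ℕ}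
    (h : History d n) : 0 ≤ coordLoss L H A j i h :=
  Finset.sum_nonneg fun _ _ => sq_nonneg _

lemma card_block_mul_le_coordLoss_add_flip (L : ℝ) (H : ℕ) (A : Finset (ℕ × Fin d)) (j : ℕ)
    (i : Fin d) {n : ℕ} (h : History d n) :
    (block n H j).card * (2 * L ^ 2 / d) ≤
      coordLoss L H A j i h + coordLoss L H (A ∆ {(j, i)}) j i h := by
  rw [coordLoss, coordLoss, ← Finset.sum_add_distrib, ← nsmul_eq_mul]
  refine Finset.card_nsmul_le_sum _ _ _ fun t _ => ?_
  have hflip : signDir (A ∆ {(j, i)}) j i = -signDir A j i := by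
    rw [signDir_symmDiff_self, PiLp.sub_apply, PiLp.single_apply, if_pos rfl]
    ring
  rw [hflip]
  linear_combination 2 * sq_nonneg ((h t).1 i) - 2 * L ^ 2 * signDir_apply_sq A j i

lemma sum_sum_coordLoss (L : ℝ) (H : ℕ) (A : Finset (ℕ × Fin d)) {n : ℕ} (h : History d n) :
    ∑ p ∈ Finset.range n ×ˢ Finset.univ, coordLoss L H A p.1 p.2 h =
      ∑ t : Fin n, ‖(h t).1 - L • signDir A (t / H)‖ ^ 2 := by
  rw [Finset.sum_product, ← sum_sum_block n H fun j t => ‖(h t).1 - L • signDir A j‖ ^ 2]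
  refine Finset.sum_congr rfl fun j _ => ?_
  simp only [coordLoss, EuclideanSpace.real_norm_sq_eq, PiLp.sub_apply, PiLp.smul_apply,
    smul_eq_mul]
  exact Finset.sum_comm

lemma integrable_ballSets (π : Policy d (ballSets d L)) (R : ℝ) (θ : ℕ → Vec d) {n : ℕ}
    {f : History d n → ℝ} (hf : Measurable f) {M : ℝ}
    (hM : ∀ h, (∀ t, ‖(h t).1‖ ≤ L) → |f h| ≤ M) : Integrable f (historyLaw π (noise R) θ n) :=
  integrable_historyLaw_of_bound (fun _ => Metric.isClosed_closedBall.measurableSet) π _ θ hf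
    fun h hh => hM h fun t => mem_closedBall_zero_iff.1 (hh t)

lemma integrable_pathDivergence (π : Policy d (ballSets d L)) (R : ℝ) (θ δ : ℕ → Vec d) (n : ℕ) :
    Integrable (pathDivergence R δ n) (historyLaw π (noise R) θ n) := by
  refine integrable_ballSets π R θ (by fun_prop)
    (M := ∑ t : Fin n, (L * ‖δ t‖) ^ 2 / (2 * R ^ 2)) fun h hh => ?_
  rw [abs_of_nonneg (pathDivergence_nonneg R δ n h)]
  refine Finset.sum_le_sum fun t _ => ?_
  rw [← sq_abs (inner ℝ (h t).1 (δ t))]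
  gcongr
  exact (abs_real_inner_le_norm _ _).trans (by gcongr; exact hh t)

lemma integrable_coordLoss (π : Policy d (ballSets d L)) (R : ℝ) (θ : ℕ → Vec d) (H : ℕ)
    (A : Finset (ℕ × Fin d)) (j : ℕ) (i : Fin d) (n : ℕ) :
    Integrable (coordLoss L H A j i) (historyLaw π (noise R) θ n) := by
  refine integrable_ballSets π R θ (by unfold coordLoss; fun_prop)
    (M := ∑ t ∈ block n H j, (L + |L * signDir A j i|) ^ 2) fun h hh => ?_
  rw [abs_of_nonneg (coordLoss_nonneg L H A j i h)]
  refine Finset.sum_le_sum fun t _ => ?_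
  rw [← sq_abs]
  gcongr
  refine (abs_sub _ _).trans ?_
  gcongr
  exact (PiLp.norm_apply_le (h t).1 i).trans (hh t)

lemma sum_integral_pathDivergence_signSeq_flip_le (π : Policy d (ballSets d L)) (R : ℝ)
    (θ : ℕ → Vec d) (hH : 1 ≤ H) (α : ℝ) (A : Finset (ℕ × Fin d)) (j n : ℕ) :
    ∑ i, ∫ h, pathDivergence R (signSeq α H (A ∆ {(j, i)}) - signSeq α H A) n h
        ∂(historyLaw π (noise R) θ n) ≤ 2 * α ^ 2 / (d * R ^ 2) * (H * L ^ 2) := by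
  have hint := fun i => integrable_pathDivergence π R θ
    (signSeq α H (A ∆ {(j, i)}) - signSeq α H A) n
  rw [← integral_finsetSum _ fun i _ => hint i]
  calc _ ≤ ∫ _, 2 * α ^ 2 / (d * R ^ 2) * (H * L ^ 2) ∂(historyLaw π (noise R) θ n) := by
        refine integral_mono_ae (integrable_finsetSum _ fun i _ => hint i) (integrable_const _) ?_
        filter_upwards [ae_historyLaw_mem (fun _ => Metric.isClosed_closedBall.measurableSet) π
          (noise R) θ n] with h hh
        exact sum_pathDivergence_signSeq_flip_le hH R α A j fun t =>
          mem_closedBall_zero_iff.1 (hh t)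
    _ = _ := by rw [integral_const, probReal_univ, one_smul]

lemma mul_exp_le_sum_exp_integral_pathDivergence (hd : 1 ≤ d) (hR : R ≠ 0) (hH : 1 ≤ H)
    (π : Policy d (ballSets d L)) (θ : ℕ → Vec d) (α : ℝ) (A : Finset (ℕ × Fin d)) (j n : ℕ) :
    d * Real.exp (-((2 * α * L / (d * R)) ^ 2 * H)) ≤
      ∑ i, Real.exp (-2 * ∫ h, pathDivergence R (signSeq α H (A ∆ {(j, i)}) - signSeq α H A) n h
        ∂(historyLaw π (noise R) θ n)) := by
  have hd' : (d : ℝ) ≠ 0 := by positivity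
  have hdiv := sum_integral_pathDivergence_signSeq_flip_le π R θ hH α A j n
  have hexp := card_mul_exp_le_sum_exp Finset.univ
    (fun i => -2 * ∫ h, pathDivergence R (signSeq α H (A ∆ {(j, i)}) - signSeq α H A) n h
      ∂(historyLaw π (noise R) θ n)) (k := -((2 * α * L / (d * R)) ^ 2 * H)) (by
    rw [← Finset.mul_sum, Finset.card_univ, Fintype.card_fin]
    calc (d : ℝ) * -((2 * α * L / (d * R)) ^ 2 * H)
        = -2 * (2 * α ^ 2 / (d * R ^ 2) * (H * L ^ 2)) := by field_simp
      _ ≤ _ := mul_le_mul_of_nonpos_left hdiv (by norm_num))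
  rwa [Finset.card_univ, Fintype.card_fin] at hexp

lemma card_block_mul_le_sum_integral_coordLoss (hd : 1 ≤ d) (hR : R ≠ 0) (hH : 1 ≤ H)
    (π : Policy d (ballSets d L)) (T : ℕ) (A : Finset (ℕ × Fin d)) (j : ℕ) :
    (block T H j).card * (L ^ 2 * Real.exp (-((2 * α * L / (d * R)) ^ 2 * H))) ≤
      ∑ i, (∫ h, coordLoss L H A j i h ∂(historyLaw π (noise R) (signSeq α H A) T) +
        ∫ h, coordLoss L H (A ∆ {(j, i)}) j i h
          ∂(historyLaw π (noise R) (signSeq α H (A ∆ {(j, i)})) T)) := by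
  have hd' : (d : ℝ) ≠ 0 := by positivity
  set v : Fin d → ℝ := fun i =>
    ∫ h, pathDivergence R (signSeq α H (A ∆ {(j, i)}) - signSeq α H A) T h
      ∂(historyLaw π (noise R) (signSeq α H A) T)
  have hpair : ∀ i, (block T H j).card * (2 * L ^ 2 / d) / 2 * Real.exp (-2 * v i) ≤
      ∫ h, coordLoss L H A j i h ∂(historyLaw π (noise R) (signSeq α H A) T) +
        ∫ h, coordLoss L H (A ∆ {(j, i)}) j i h
          ∂(historyLaw π (noise R) (signSeq α H (A ∆ {(j, i)})) T) := fun i => by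
    have := half_mul_exp_neg_pathDivergence_le π hR (signSeq α H A)
      (signSeq α H (A ∆ {(j, i)}) - signSeq α H A) (by positivity) (coordLoss_nonneg L H A j i)
      (coordLoss_nonneg L H _ j i) (card_block_mul_le_coordLoss_add_flip L H A j i)
      (integrable_coordLoss π R _ H A j i T) (integrable_coordLoss π R _ H _ j i T)
      (integrable_pathDivergence π R _ _ T)
    rwa [add_sub_cancel] at this
  calc (block T H j).card * (L ^ 2 * Real.exp (-((2 * α * L / (d * R)) ^ 2 * H)))
      = (block T H j).card * (2 * L ^ 2 / d) / 2 *
          (d * Real.exp (-((2 * α * L / (d * R)) ^ 2 * H))) := by field_simp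
    _ ≤ (block T H j).card * (2 * L ^ 2 / d) / 2 * ∑ i, Real.exp (-2 * v i) := by
        gcongr
        exact mul_exp_le_sum_exp_integral_pathDivergence hd hR hH π (signSeq α H A) α A j T
    _ ≤ _ := by
        rw [Finset.mul_sum]
        exact Finset.sum_le_sum fun i _ => hpair i

lemma exists_le_integral_sum_norm_sub_sq (hd : 1 ≤ d) (hR : R ≠ 0) (hH : 1 ≤ H)
    (π : Policy d (ballSets d L)) (α : ℝ) (T : ℕ) :
    ∃ A : Finset (ℕ × Fin d),
      T * (L ^ 2 * Real.exp (-((2 * α * L / (d * R)) ^ 2 * H))) / 2 ≤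
        ∫ h, ∑ t : Fin T, ‖(h t).1 - L • signDir A (t / H)‖ ^ 2
          ∂(historyLaw π (noise R) (signSeq α H A) T) := by
  obtain ⟨A, hA⟩ := exists_half_le_sum_of_le_sum_add_flip (Finset.range T ×ˢ Finset.univ)
    (fun A p => ∫ h, coordLoss L H A p.1 p.2 h ∂(historyLaw π (noise R) (signSeq α H A) T))
    (M := T * (L ^ 2 * Real.exp (-((2 * α * L / (d * R)) ^ 2 * H)))) fun A => by
      have hcard : ∑ j ∈ Finset.range T, ((block T H j).card : ℝ) = T := by
        simpa using sum_sum_block T H fun _ _ => 1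
      rw [Finset.sum_product, ← hcard, Finset.sum_mul]
      exact Finset.sum_le_sum fun j _ =>
        card_block_mul_le_sum_integral_coordLoss hd hR hH π T A j
  refine ⟨A, hA.trans_eq ?_⟩
  rw [← integral_finsetSum _ fun p _ => integrable_coordLoss π R _ H A p.1 p.2 T]
  simp only [sum_sum_coordLoss]

lemma mul_norm_sub_sq_le_regret (hd : 1 ≤ d) (hL : 0 < L) (hα : 0 ≤ α) (H : ℕ)
    (A : Finset (ℕ × Fin d)) (t : ℕ) {x : Vec d} (hx : ‖x‖ ≤ L) :
    α / (2 * L) * ‖x - L • signDir A (t / H)‖ ^ 2 ≤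
      (⨆ y : ballSets d L t, inner ℝ (y : Vec d) (signSeq α H A t)) -
        inner ℝ x (signSeq α H A t) := by
  have hu := norm_signDir hd A (t / H)
  have hsup : ⨆ y : ballSets d L t, inner ℝ (y : Vec d) (signSeq α H A t) = L * α := by
    refine (iSup_inner_closedBall hL.le _).trans ?_
    rw [signSeq, norm_smul_signDir hd hα]
  rw [hsup, signSeq, real_inner_smul_right]
  calc α / (2 * L) * ‖x - L • signDir A (t / H)‖ ^ 2
      ≤ α / (2 * L) * (2 * L * (L - inner ℝ x (signDir A (t / H)))) := by
        gcongr
        exact norm_sub_smul_sq_le hx hu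
    _ = L * α - α * inner ℝ x (signDir A (t / H)) := by field_simp

lemma integrable_regret (π : Policy d (ballSets d L)) (R : ℝ) (θ θ' : ℕ → Vec d) (n : ℕ) :
    Integrable (fun h : History d n => ∑ t : Fin n,
      ((⨆ x : ballSets d L t, inner ℝ (x : Vec d) (θ' t)) - inner ℝ (h t).1 (θ' t)))
      (historyLaw π (noise R) θ n) := by
  refine integrable_ballSets π R θ (by fun_prop) (M := ∑ t : Fin n,
    (|⨆ x : ballSets d L t, inner ℝ (x : Vec d) (θ' t)| + L * ‖θ' t‖)) fun h hh => ?_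
  refine (Finset.abs_sum_le_sum_abs _ _).trans (Finset.sum_le_sum fun t _ => ?_)
  refine (abs_sub _ _).trans ?_
  gcongr
  exact (abs_real_inner_le_norm _ _).trans (by gcongr; exact hh t)

lemma exists_signSeq_le_expectedRegret (hd : 1 ≤ d) (hL : 0 < L) (hR : R ≠ 0) (hα : 0 ≤ α)
    (hH : 1 ≤ H) (π : Policy d (ballSets d L)) (T : ℕ) :
    ∃ A : Finset (ℕ × Fin d),
      L * Real.exp (-((2 * α * L / (d * R)) ^ 2 * H)) / 4 * (α * T) ≤
        expectedRegret π (noise R) T (signSeq α H A) := by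
  obtain ⟨A, hA⟩ := exists_le_integral_sum_norm_sub_sq hd hR hH π α T
  refine ⟨A, ?_⟩
  calc L * Real.exp (-((2 * α * L / (d * R)) ^ 2 * H)) / 4 * (α * T)
      = α / (2 * L) * (T * (L ^ 2 * Real.exp (-((2 * α * L / (d * R)) ^ 2 * H))) / 2) := by
        field_simp
        ring
    _ ≤ α / (2 * L) * ∫ h, ∑ t : Fin T, ‖(h t).1 - L • signDir A (t / H)‖ ^ 2
          ∂(historyLaw π (noise R) (signSeq α H A) T) := by gcongr
    _ = ∫ h, α / (2 * L) * ∑ t : Fin T, ‖(h t).1 - L • signDir A (t / H)‖ ^ 2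
          ∂(historyLaw π (noise R) (signSeq α H A) T) := (integral_const_mul _ _).symm
    _ ≤ expectedRegret π (noise R) T (signSeq α H A) := by
        refine integral_mono_of_nonneg (ae_of_all _ fun h => by positivity) ?_ ?_
        · exact integrable_regret π R _ _ T
        · filter_upwards [ae_historyLaw_mem (fun _ => Metric.isClosed_closedBall.measurableSet) π
            (noise R) (signSeq α H A) T] with h hh
          rw [Finset.mul_sum]
          exact Finset.sum_le_sum fun t _ =>
            mul_norm_sub_sq_le_regret hd hL hα H A t (mem_closedBall_zero_iff.1 (hh t))

end SignSeq

/-! ### The minimax rate and the block length -/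

section Rate

variable {d T : ℕ} {B : ℝ}

lemma rpow_one_third_pow_three {x : ℝ} (hx : 0 ≤ x) : (x ^ (1 / 3 : ℝ)) ^ 3 = x := by
  simpa only [one_div, Nat.cast_ofNat] using Real.rpow_inv_natCast_pow hx three_ne_zero

lemma rpow_two_thirds {x : ℝ} (hx : 0 ≤ x) : x ^ (2 / 3 : ℝ) = (x ^ (1 / 3 : ℝ)) ^ 2 := by
  rw [← Real.rpow_natCast, ← Real.rpow_mul hx]
  norm_num

lemma rate_nonneg (d T : ℕ) (hB : 0 ≤ B) : 0 ≤ rate d T B := by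
  unfold rate
  positivity

lemma rate_pow_three (d T : ℕ) (hB : 0 ≤ B) : rate d T B ^ 3 = (d : ℝ) ^ 2 * B * T ^ 2 := by
  rw [rate, rpow_two_thirds d.cast_nonneg, rpow_two_thirds T.cast_nonneg, mul_pow, mul_pow,
    pow_right_comm, pow_right_comm _ 2 3, rpow_one_third_pow_three hB,
    rpow_one_third_pow_three d.cast_nonneg, rpow_one_third_pow_three T.cast_nonneg]

lemma rate_le_mul (hB : 0 ≤ B) {K : ℝ} (hK : 0 ≤ K) (h : (d : ℝ) ^ 2 * B ≤ K ^ 3 * T) :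
    rate d T B ≤ K * T := by
  refine le_of_pow_le_pow_left₀ three_ne_zero (by positivity) ?_
  calc rate d T B ^ 3 = (d : ℝ) ^ 2 * B * T ^ 2 := rate_pow_three d T hB
    _ ≤ K ^ 3 * T * T ^ 2 := by gcongr
    _ = (K * T) ^ 3 := by ring

lemma rate_mul_rpow (d T : ℕ) (hB : 0 < B) :
    rate d T B * ((d : ℝ) * T / B) ^ (1 / 3 : ℝ) = d * T := by
  have hr := rate_nonneg d T hB.le
  refine (pow_left_inj₀ (by positivity) (by positivity) three_ne_zero).1 ?_
  rw [mul_pow, rate_pow_three d T hB.le, rpow_one_third_pow_three (by positivity)]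
  field_simp

lemma one_le_blockLength (hd : 1 ≤ d) (hT : 1 ≤ T) (hB : 0 < B) : 1 ≤ blockLength d T B :=
  Nat.one_le_ceil_iff.2 (by positivity)

lemma rpow_le_sqrt_blockLength (d T : ℕ) (hB : 0 ≤ B) :
    ((d : ℝ) * T / B) ^ (1 / 3 : ℝ) ≤ √(blockLength d T B) := by
  refine Real.le_sqrt_of_sq_le ?_
  rw [← rpow_two_thirds (by positivity)]
  exact Nat.le_ceil _

lemma sqrt_blockLength_le (d T : ℕ) (hB : 0 ≤ B) :
    √(blockLength d T B) ≤ 2 * max 1 (((d : ℝ) * T / B) ^ (1 / 3 : ℝ)) := by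
  set q := ((d : ℝ) * T / B) ^ (1 / 3 : ℝ) with hq
  have hH : (blockLength d T B : ℝ) ≤ q ^ 2 + 1 := by
    rw [hq, ← rpow_two_thirds (by positivity)]
    exact (Nat.ceil_lt_add_one (by positivity)).le
  have hq0 : 0 ≤ q := by positivity
  refine Real.sqrt_le_iff.2 ⟨by positivity, ?_⟩
  nlinarith [le_max_left 1 q, le_max_right 1 q]

lemma div_sqrt_blockLength_mul_le (hd : 1 ≤ d) (hT : 1 ≤ T) (hB : 0 < B) :
    (d : ℝ) / √(blockLength d T B) * (T / blockLength d T B) ≤ B := by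
  have hH : (0 : ℝ) < blockLength d T B := by exact_mod_cast one_le_blockLength hd hT hB
  have hcube : √(blockLength d T B : ℝ) ^ 3 = √(blockLength d T B) * blockLength d T B := by
    rw [pow_succ, Real.sq_sqrt hH.le, mul_comm]
  rw [div_mul_div_comm, ← hcube, div_le_iff₀ (by positivity), ← div_le_iff₀' hB,
    ← rpow_one_third_pow_three (x := (d : ℝ) * T / B) (by positivity)]
  gcongr
  exact rpow_le_sqrt_blockLength d T hB.le

lemma min_rate_div_four_le (hd : 1 ≤ d) (hT : 1 ≤ T) (hB : 0 < B) :
    min ((d : ℝ) * T) (rate d T B) / 4 ≤ d / (2 * √(blockLength d T B)) * T := by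
  have hH : (0 : ℝ) < blockLength d T B := by exact_mod_cast one_le_blockLength hd hT hB
  have hr := rate_nonneg d T hB.le
  set q := ((d : ℝ) * T / B) ^ (1 / 3 : ℝ)
  have hmin : min ((d : ℝ) * T) (rate d T B) * max 1 q ≤ d * T := by
    rw [mul_max_of_nonneg _ _ (by positivity), mul_one]
    refine max_le (min_le_left _ _) ?_
    rw [← rate_mul_rpow d T hB]
    gcongr
    exact min_le_right _ _
  rw [div_mul_eq_mul_div, div_le_div_iff₀ (by norm_num) (by positivity)]
  calc min ((d : ℝ) * T) (rate d T B) * (2 * √(blockLength d T B))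
      ≤ min ((d : ℝ) * T) (rate d T B) * (2 * (2 * max 1 q)) := by
        gcongr
        exact sqrt_blockLength_le d T hB.le
    _ = 4 * (min ((d : ℝ) * T) (rate d T B) * max 1 q) := by ring
    _ ≤ d * T * 4 := by linarith

lemma min_mul_min_rate_le (hd : 1 ≤ d) (hT : 1 ≤ T) (hB : 0 < B) {s : ℝ} (hs : 0 ≤ s) :
    min s (1 / 4) * min (T : ℝ) (rate d T B) ≤
      min s ((d : ℝ) / (2 * √(blockLength d T B))) * T := by
  have hr := rate_nonneg d T hB.le
  have hd' : (1 : ℝ) ≤ d := by exact_mod_cast hd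
  rw [min_mul_of_nonneg _ _ T.cast_nonneg]
  refine le_min (by gcongr <;> exact min_le_left _ _) ?_
  calc min s (1 / 4) * min (T : ℝ) (rate d T B)
      ≤ 1 / 4 * min ((d : ℝ) * T) (rate d T B) := by
        gcongr
        · exact min_le_right _ _
        · exact le_mul_of_one_le_left T.cast_nonneg hd'
    _ = min ((d : ℝ) * T) (rate d T B) / 4 := by ring
    _ ≤ d / (2 * √(blockLength d T B)) * T := min_rate_div_four_le hd hT hB

end Rate

section Budget

variable {B : ℕ → ℝ}

lemma eventually_rate_le (d : ℕ) (hB : ∀ T, 0 ≤ B T) (h : B =o[atTop] fun T : ℕ => (T : ℝ)) :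
    ∀ᶠ T : ℕ in atTop, rate d T (B T) ≤ T := by
  filter_upwards [(h.const_mul_left ((d : ℝ) ^ 2)).bound one_pos] with T hT
  have hdB : (d : ℝ) ^ 2 * B T ≤ 1 ^ 3 * T := by
    simpa only [one_pow, Real.norm_natCast] using (Real.le_norm_self _).trans hT
  simpa only [one_mul] using rate_le_mul (hB T) zero_le_one hdB

lemma exists_pos_mul_rate_le_min (d : ℕ) (hB : ∀ T, 0 ≤ B T)
    (h : B =O[atTop] fun T : ℕ => (T : ℝ)) :
    ∃ k : ℝ, 0 < k ∧ ∀ T : ℕ, 1 ≤ T → k * rate d T (B T) ≤ min (T : ℝ) (rate d T (B T)) := by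
  obtain ⟨C, hC, hBC⟩ := bound_of_isBigO_nat_atTop h
  set K := 1 + (d : ℝ) ^ 2 * C
  have hK : 1 ≤ K := le_add_of_nonneg_right (by positivity)
  have hK0 := zero_lt_one.trans_le hK
  refine ⟨K⁻¹, inv_pos.2 hK0, fun T hT => ?_⟩
  have hBT : B T ≤ C * T := by
    simpa only [Real.norm_natCast] using (Real.le_norm_self _).trans (hBC (by positivity))
  have hrate : rate d T (B T) ≤ K * T := by
    refine rate_le_mul (hB T) hK0.le ?_
    calc (d : ℝ) ^ 2 * B T ≤ d ^ 2 * (C * T) := by gcongr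
      _ ≤ K * T := by rw [← mul_assoc]; gcongr; exact le_add_of_nonneg_left zero_le_one
      _ ≤ K ^ 3 * T := by gcongr; exact le_self_pow₀ hK three_ne_zero
  refine le_min ((inv_mul_le_iff₀ hK0).2 hrate) ?_
  exact mul_le_of_le_one_left (rate_nonneg d T (hB T)) (inv_le_one_of_one_le₀ hK)

lemma isLittleO_natCast_of_isBigO_rpow {ρ : ℝ} (hρ : ρ < 1)
    (h : B =O[atTop] fun T : ℕ => (T : ℝ) ^ ρ) : B =o[atTop] fun T : ℕ => (T : ℝ) := by
  have hpow : (fun x : ℝ => x ^ ρ) =o[atTop] fun x : ℝ => x := by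
    refine (isLittleO_iff_tendsto' ?_).2 ((tendsto_rpow_neg_atTop (sub_pos.2 hρ)).congr' ?_)
    · filter_upwards [eventually_gt_atTop 0] with x hx h using absurd h hx.ne'
    · filter_upwards [eventually_gt_atTop 0] with x hx
      rw [neg_sub, Real.rpow_sub_one hx.ne']
  exact h.trans_isLittleO (hpow.comp_tendsto tendsto_natCast_atTop_atTop)

end Budget

/-! ### The lower bounds -/

section LowerBound

variable {d T H : ℕ} {R L S B α : ℝ}

lemma variation_comp_div_le {β : ℕ → Vec d} (hβ : ∀ j, ‖β j‖ ≤ α) (T H : ℕ) :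
    variation T (fun t => β (t / H)) ≤ 2 * α * (T / H) := by
  have hα : 0 ≤ α := (norm_nonneg _).trans (hβ 0)
  have hjumps : ∀ n : ℕ, ∑ t ∈ Finset.range n, ‖β ((t + 1) / H) - β (t / H)‖ ≤
      2 * α * (n / H : ℕ) := fun n => by
    induction n with
    | zero => simp
    | succ n ih =>
      rw [Finset.sum_range_succ, Nat.succ_div]
      split_ifs
      · have hjump := norm_sub_le_of_le (hβ (n / H + 1)) (hβ (n / H))
        push_cast
        linarith
      · simpa only [add_zero, sub_self, norm_zero] using ih
  refine (hjumps (T - 1)).trans ?_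
  gcongr
  refine Nat.cast_div_le.trans ?_
  gcongr
  exact T.sub_le 1

lemma signSeq_mem_admissible (hd : 1 ≤ d) (hα : 0 ≤ α) (A : Finset (ℕ × Fin d)) (hS : α ≤ S)
    (hL : L * α ≤ 1) (hB : 2 * α * (T / H) ≤ B) :
    signSeq α H A ∈ admissible (ballSets d L) S T B := by
  have hnorm := norm_smul_signDir hd hα A
  refine ⟨fun t _ => ⟨(hnorm (t / H)).trans_le hS, fun x hx => ?_⟩,
    (variation_comp_div_le (fun j => (hnorm j).le) T H).trans hB⟩
  refine (abs_real_inner_le_norm _ _).trans (le_trans ?_ hL)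
  rw [signSeq, hnorm]
  gcongr
  exact mem_closedBall_zero_iff.1 hx

lemma signSeq_mem_blockSequences (T H : ℕ) (A : Finset (ℕ × Fin d)) :
    signSeq (d / (2 * √H)) H A ∈ blockSequences d T H := by
  have hcoord : (d : ℝ) / (2 * √H) / √d = √((d : ℝ) / (4 * H)) := by
    rw [Real.sqrt_div d.cast_nonneg, Real.sqrt_mul zero_le_four, div_right_comm, Real.div_sqrt]
    norm_num
  refine ⟨fun j => (d / (2 * √H)) • signDir A j, fun j i => ?_, fun t _ => rfl⟩
  simp only [PiLp.smul_apply, signDir, smul_eq_mul, ← hcoord]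
  split_ifs
  · exact Or.inr (by ring)
  · exact Or.inl (by ring)

lemma le_dynamicRegret (hd : 1 ≤ d) (hL : 0 < L) (hR : R ≠ 0) (hα : 0 ≤ α) (hH : 1 ≤ H)
    (hαH : α ≤ d / (2 * √H)) (π : Policy d (ballSets d L)) (T : ℕ) {C : Set (ℕ → Vec d)}
    (hC : ∀ A, signSeq α H A ∈ C) :
    ((L * Real.exp (-(L / R) ^ 2) / 4 * (α * T) : ℝ) : EReal) ≤
      dynamicRegret π (noise R) T C := by
  obtain ⟨A, hA⟩ := exists_signSeq_le_expectedRegret hd hL hR hα hH π T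
  have hinfo : (2 * α * L / (d * R)) ^ 2 * H ≤ (L / R) ^ 2 := by
    have hscale : (2 * α / d * √H) ^ 2 ≤ 1 := by
      refine pow_le_one₀ (by positivity) ?_
      calc 2 * α / d * √H ≤ 2 * (d / (2 * √H)) / d * √H := by gcongr
        _ = 1 := by field_simp
    calc (2 * α * L / (d * R)) ^ 2 * H = (2 * α / d * √H) ^ 2 * (L / R) ^ 2 := by
          rw [mul_pow _ √(H : ℝ), Real.sq_sqrt H.cast_nonneg]
          ring
      _ ≤ (L / R) ^ 2 := mul_le_of_le_one_left (sq_nonneg _) hscale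
  refine le_trans (EReal.coe_le_coe_iff.2 ?_)
    (le_iSup₂ (f := fun θ (_ : θ ∈ C) => (expectedRegret π (noise R) T θ : EReal)) _ (hC A))
  refine le_trans ?_ hA
  gcongr

/-- The constant in front of the rate in the lower bounds. -/
def regretConst (R L S : ℝ) : ℝ :=
  L * Real.exp (-(L / R) ^ 2) / 4 * min (min S (1 / L)) (1 / 4)

lemma regretConst_pos (R : ℝ) (hL : 0 < L) (hS : 0 < S) : 0 < regretConst R L S := by
  unfold regretConst
  positivity

lemma le_dynamicRegret_admissible (hd : 1 ≤ d) (hT : 1 ≤ T) (hL : 0 < L) (hR : R ≠ 0)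
    (hS : 0 ≤ S) (hB : 0 < B) (π : Policy d (ballSets d L)) :
    ((regretConst R L S * min (T : ℝ) (rate d T B) : ℝ) : EReal) ≤
      dynamicRegret π (noise R) T (admissible (ballSets d L) S T B) := by
  have hs : 0 ≤ min S (1 / L) := by positivity
  set H := blockLength d T B
  set α := min (min S (1 / L)) ((d : ℝ) / (2 * √H))
  have hα : 0 ≤ α := by positivity
  have hαH : α ≤ d / (2 * √H) := min_le_right _ _
  have hαS : α ≤ S := (min_le_left _ _).trans (min_le_left _ _)
  have hαL : L * α ≤ 1 := (le_div_iff₀' hL).1 ((min_le_left _ _).trans (min_le_right _ _))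
  have hαB : 2 * α * (T / H) ≤ B :=
    calc 2 * α * (T / H) ≤ 2 * (d / (2 * √H)) * (T / H) := by gcongr
      _ = d / √H * (T / H) := by ring
      _ ≤ B := div_sqrt_blockLength_mul_le hd hT hB
  refine le_trans (EReal.coe_le_coe_iff.2 ?_) (le_dynamicRegret hd hL hR hα
    (one_le_blockLength hd hT hB) hαH π T fun A => signSeq_mem_admissible hd hα A hαS hαL hαB)
  rw [regretConst, mul_assoc]
  exact mul_le_mul_of_nonneg_left (min_mul_min_rate_le hd hT hB hs) (by positivity)

lemma le_dynamicRegret_blockSequences (hd : 1 ≤ d) (hT : 1 ≤ T) (hL : 0 < L) (hR : R ≠ 0)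
    (hB : 0 < B) (hBd : B ≤ d * T) (hSd : (d : ℝ) / (2 * √(blockLength d T B)) ≤ S)
    (hLd : L * ((d : ℝ) / (2 * √(blockLength d T B))) ≤ 1) (π : Policy d (ballSets d L)) :
    ((regretConst R L S * rate d T B : ℝ) : EReal) ≤ dynamicRegret π (noise R) T
      (admissible (ballSets d L) S T B ∩ blockSequences d T (blockLength d T B)) := by
  set H := blockLength d T B
  set α := (d : ℝ) / (2 * √H)
  have hα : 0 ≤ α := by positivity
  have hαB : 2 * α * (T / H) ≤ B :=
    calc 2 * α * (T / H) = d / √H * (T / H) := by ring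
      _ ≤ B := div_sqrt_blockLength_mul_le hd hT hB
  have hrate : rate d T B ≤ d * T :=
    rate_le_mul hB.le d.cast_nonneg <|
      calc (d : ℝ) ^ 2 * B ≤ (d : ℝ) ^ 2 * (d * T) := by gcongr
        _ = (d : ℝ) ^ 3 * T := by ring
  have hr := rate_nonneg d T hB.le
  have hrate_mul : min (min S (1 / L)) (1 / 4) * rate d T B ≤ α * T :=
    calc min (min S (1 / L)) (1 / 4) * rate d T B ≤ 1 / 4 * rate d T B := by
          gcongr
          exact min_le_right _ _
      _ = min ((d : ℝ) * T) (rate d T B) / 4 := by rw [min_eq_right hrate]; ring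
      _ ≤ α * T := min_rate_div_four_le hd hT hB
  refine le_trans (EReal.coe_le_coe_iff.2 ?_) (le_dynamicRegret hd hL hR hα
    (one_le_blockLength hd hT hB) le_rfl π T fun A =>
      ⟨signSeq_mem_admissible hd hα A hSd hLd hαB, signSeq_mem_blockSequences T H A⟩)
  rw [regretConst, mul_assoc]
  gcongr

end LowerBound

end DriftingBandit

end

theorem theorem1_general (R L S : ℝ) (hR : 0 < R) (hL : 0 < L) (hS : 0 < S) :
    ∃ c : ℝ, 0 < c ∧
      (∀ d T : ℕ, 1 ≤ d → 1 ≤ T → ∀ B : ℝ, 0 < B →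
        ∀ π : DriftingBandit.Policy d (DriftingBandit.ballSets d L),
          ((c * min (T : ℝ) (DriftingBandit.rate d T B) : ℝ) : EReal) ≤
            DriftingBandit.dynamicRegret π (DriftingBandit.noise R) T
              (DriftingBandit.admissible (DriftingBandit.ballSets d L) S T B)) ∧
      (∀ d : ℕ, 1 ≤ d → ∀ B : ℕ → ℝ, (∀ T, 0 < B T) →
        (B =o[atTop] (fun T : ℕ => (T : ℝ)) → ∀ᶠ T : ℕ in atTop,
          ∀ π : DriftingBandit.Policy d (DriftingBandit.ballSets d L),
            ((c * DriftingBandit.rate d T (B T) : ℝ) : EReal) ≤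
              DriftingBandit.dynamicRegret π (DriftingBandit.noise R) T
                (DriftingBandit.admissible (DriftingBandit.ballSets d L) S T (B T))) ∧
        (B =O[atTop] (fun T : ℕ => (T : ℝ)) → ∃ c' : ℝ, 0 < c' ∧ ∀ T : ℕ, 1 ≤ T →
          ∀ π : DriftingBandit.Policy d (DriftingBandit.ballSets d L),
            ((c' * DriftingBandit.rate d T (B T) : ℝ) : EReal) ≤
              DriftingBandit.dynamicRegret π (DriftingBandit.noise R) T
                (DriftingBandit.admissible (DriftingBandit.ballSets d L) S T (B T)))) ∧
      (∀ d T : ℕ, 1 ≤ d → 1 ≤ T → ∀ B : ℝ, 0 < B → B ≤ d * T →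
        (d : ℝ) / (2 * √(DriftingBandit.blockLength d T B)) ≤ S →
        L * ((d : ℝ) / (2 * √(DriftingBandit.blockLength d T B))) ≤ 1 →
        ∀ π : DriftingBandit.Policy d (DriftingBandit.ballSets d L),
          ((c * DriftingBandit.rate d T B : ℝ) : EReal) ≤
            DriftingBandit.dynamicRegret π (DriftingBandit.noise R) T
              (DriftingBandit.admissible (DriftingBandit.ballSets d L) S T B ∩
                DriftingBandit.blockSequences d T (DriftingBandit.blockLength d T B))) := by
  have hc := DriftingBandit.regretConst_pos R hL hS
  refine ⟨DriftingBandit.regretConst R L S, hc, ?_, fun d hd B hB => ⟨fun hBo => ?_, fun hBO => ?_⟩,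
    ?_⟩
  · exact fun d T hd hT B hB π =>
      DriftingBandit.le_dynamicRegret_admissible hd hT hL hR.ne' hS.le hB π
  · filter_upwards [DriftingBandit.eventually_rate_le d (fun T => (hB T).le) hBo,
      eventually_ge_atTop 1] with T hrate hT π
    simpa only [min_eq_right hrate] using
      DriftingBandit.le_dynamicRegret_admissible hd hT hL hR.ne' hS.le (hB T) π
  · obtain ⟨k, hk, hrate⟩ :=
      DriftingBandit.exists_pos_mul_rate_le_min d (fun T => (hB T).le) hBO
    refine ⟨_, mul_pos hc hk, fun T hT π => le_trans (EReal.coe_le_coe_iff.2 ?_)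
      (DriftingBandit.le_dynamicRegret_admissible hd hT hL hR.ne' hS.le (hB T) π)⟩
    rw [mul_assoc]
    exact mul_le_mul_of_nonneg_left (hrate T hT) hc.le
  · exact fun d T hd hT B hB hBd hSd hLd π =>
      DriftingBandit.le_dynamicRegret_blockSequences hd hT hL hR.ne' hB hBd hSd hLd π

theorem theorem1 (R L S : ℝ) (hR : 0 < R) (hL : 0 < L) (hS : 0 < S) :
    ∃ c : ℝ, 0 < c ∧
      -- all dimensions, horizons and budgets at once, with one constant
      (∀ d T : ℕ, 1 ≤ d → d ≤ T → ∀ B : ℝ, 0 < B →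
        ∀ π : DriftingBandit.Policy d (DriftingBandit.ballSets d L),
          ((c * min (T : ℝ) (DriftingBandit.rate d T B) : ℝ) : EReal) ≤
            DriftingBandit.dynamicRegret π (DriftingBandit.noise R) T
              (DriftingBandit.admissible (DriftingBandit.ballSets d L) S T B)) ∧
      -- budgets of order `T ^ ρ`: the full rate for all large `T` with the same constant, and for
      -- all `T ≥ d` with a constant that may depend on `d` and on the budgets
      (∀ d : ℕ, 1 ≤ d → ∀ (B : ℕ → ℝ) (ρ : ℝ), (∀ T, 0 < B T) → 0 < ρ → ρ < 1 →
        B =Θ[atTop] (fun T : ℕ => (T : ℝ) ^ ρ) →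
          (∀ᶠ T : ℕ in atTop,
            ∀ π : DriftingBandit.Policy d (DriftingBandit.ballSets d L),
              ((c * DriftingBandit.rate d T (B T) : ℝ) : EReal) ≤
                DriftingBandit.dynamicRegret π (DriftingBandit.noise R) T
                  (DriftingBandit.admissible (DriftingBandit.ballSets d L) S T (B T))) ∧
          ∃ c' : ℝ, 0 < c' ∧ ∀ T : ℕ, d ≤ T →
            ∀ π : DriftingBandit.Policy d (DriftingBandit.ballSets d L),
              ((c' * DriftingBandit.rate d T (B T) : ℝ) : EReal) ≤
                DriftingBandit.dynamicRegret π (DriftingBandit.noise R) T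
                  (DriftingBandit.admissible (DriftingBandit.ballSets d L) S T (B T))) ∧
      -- the full rate is already forced by the block instances, whenever these are normalized
      (∀ d T : ℕ, 1 ≤ d → d ≤ T → ∀ B : ℝ, 0 < B → B ≤ d * T →
        (d : ℝ) / (2 * √(DriftingBandit.blockLength d T B)) ≤ S →
        L * ((d : ℝ) / (2 * √(DriftingBandit.blockLength d T B))) ≤ 1 →
        ∀ π : DriftingBandit.Policy d (DriftingBandit.ballSets d L),
          ((c * DriftingBandit.rate d T B : ℝ) : EReal) ≤
            DriftingBandit.dynamicRegret π (DriftingBandit.noise R) T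
              (DriftingBandit.admissible (DriftingBandit.ballSets d L) S T B ∩
                DriftingBandit.blockSequences d T (DriftingBandit.blockLength d T B))) := by
  obtain ⟨c, hc, hmin, hbudget, hblock⟩ := theorem1_general R L S hR hL hS
  refine ⟨c, hc, fun d T hd hdT => hmin d T hd (hd.trans hdT), fun d hd B ρ hB _ hρ hBρ => ?_,
    fun d T hd hdT => hblock d T hd (hd.trans hdT)⟩
  have hBT := DriftingBandit.isLittleO_natCast_of_isBigO_rpow hρ hBρ.isBigO
  obtain ⟨c', hc', hT⟩ := (hbudget d hd B hB).2 hBT.isBigO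
  exact ⟨(hbudget d hd B hB).1 hBT, c', hc', fun T hdT => hT T (hd.trans hdT)⟩
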